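/- Let $m\in\mathbb N$, let $U\subseteq\mathbb R^{2m}$ be open, let $H:U\to\mathbb R$ be smooth ($C^\infty$), let $J=\begin{pmatrix}0&I_m\\-I_m&0\end{pmatrix}$, and let $y:[t_0,T]\to U$, $T>t_0$, solve $y'=J\nabla H(y)$, $y(t_0)=y_0$, where $\nabla H(y_0)\neq 0$. For small $h>0$ let $y_1=y_1(h)\in\mathbb R^{2m}$ satisfy $y(t_0+h)=y_1+O(h^5)$ as $h\to0^+$. For $z\in\mathbb R^{2m}$ put $$\gamma_z(\tau)=y_0+(z-y_0)\tau+2(z-2y_1+y_0)\tau(\tau-1),\qquad a(z)=\int_0^1\nabla H(\gamma_z(\tau))\,d\tau,$$ $$r(z)=-2(z-2y_1+y_0)^T\int_0^1(2\tau-1)\nabla H(\gamma_z(\tau))\,d\tau,$$ and consider the equation, with $\|\cdot\|$ the Euclidean norm, $$z=y_0+2hJa(z)+\frac{r(z)}{\|a(z)\|^2}\,a(z).\qquad(*)$$ Then there are $\rho>0$ and $h_0>0$ such that for every $0<h\le h_0$ the terms of $(*)$ are well defined for every $z$ in the ball $B(y_0,\rho)$ (that is, $\gamma_z([0,1])\subseteq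 U$ and $a(z)\ne0$), and $(*)$ has a unique solution $z^*=z^*(h)$ in $B(y_0,\rho)$. This solution satisfies $y(t_0+2h)-z^*=O(h^5)$ as $h\to0^+$, i.e. the method has order four. Moreover, for every $h>0$, every solution $z\in\mathbb R^{2m}$ of $(*)$ with $\gamma_z([0,1])\subseteq U$ and $a(z)\neq0$ satisfies $H(z)=H(y_0)$. -/

import Mathlib

open Filter Topology Asymptotics
open scoped ContDiff

noncomputable section

namespace EnergyTwoStep

/-- The phase space `ℝ^{2m}` with the Euclidean norm; a point is a pair of blocks of length `m`. -/
abbrev Phase (m : ℕ) : Type := EuclideanSpace ℝ (Fin m ⊕ Fin m)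

/-- The canonical structure matrix `J = [[0, I], [-I, 0]]`, as a linear map. -/
def J (m : ℕ) : Phase m →L[ℝ] Phase m :=
  Matrix.toEuclideanCLM (𝕜 := ℝ)
    (Matrix.fromBlocks 0 1 (-1) 0 : Matrix (Fin m ⊕ Fin m) (Fin m ⊕ Fin m) ℝ)

/-- `y` solves `y' = J ∇H(y)`, `y(t₀) = y₀` on the interval `[t₀, T]`, with values in the
domain `U` of `H`. -/
structure IsHamiltonianSolution {m : ℕ} (U : Set (Phase m)) (H : Phase m → ℝ)
    (y₀ : Phase m) (t₀ T : ℝ) (y : ℝ → Phase m) : Prop where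
  init : y t₀ = y₀
  mem : ∀ t ∈ Set.Icc t₀ T, y t ∈ U
  deriv : ∀ t ∈ Set.Icc t₀ T,
    HasDerivWithinAt y (J m (gradient H (y t))) (Set.Icc t₀ T) t

/-- The quadratic curve through `y₀`, `y₁`, `z` at `τ = 0, 1/2, 1`. -/
def curve {m : ℕ} (y₀ y₁ z : Phase m) (τ : ℝ) : Phase m :=
  y₀ + τ • (z - y₀) + (2 * (τ * (τ - 1))) • (z - (2 : ℝ) • y₁ + y₀)

/-- `a(z) = ∫₀¹ ∇H(γ_z(τ)) dτ`. -/
def a {m : ℕ} (H : Phase m → ℝ) (y₀ y₁ z : Phase m) : Phase m :=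
  ∫ τ in (0 : ℝ)..1, gradient H (curve y₀ y₁ z τ)

/-- `r(z) = -2 (z - 2 y₁ + y₀)ᵀ ∫₀¹ (2τ - 1) ∇H(γ_z(τ)) dτ`. -/
def r {m : ℕ} (H : Phase m → ℝ) (y₀ y₁ z : Phase m) : ℝ :=
  -2 * inner ℝ (z - (2 : ℝ) • y₁ + y₀)
    (∫ τ in (0 : ℝ)..1, (2 * τ - 1) • gradient H (curve y₀ y₁ z τ))

/-- The terms of the method are meaningful at `z`: the curve stays in the domain of `H`, and
the denominator does not vanish. -/
def WellDefinedAt {m : ℕ} (U : Set (Phase m)) (H : Phase m → ℝ) (y₀ y₁ z : Phase m) : Prop :=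
  (∀ τ ∈ Set.Icc (0 : ℝ) 1, curve y₀ y₁ z τ ∈ U) ∧ a H y₀ y₁ z ≠ 0

/-- The equation of the method with stepsize `h`, in the unknown `z`. -/
def MethodEq {m : ℕ} (H : Phase m → ℝ) (y₀ y₁ : Phase m) (h : ℝ) (z : Phase m) : Prop :=
  z = y₀ + (2 * h) • J m (a H y₀ y₁ z)
    + (r H y₀ y₁ z / ‖a H y₀ y₁ z‖ ^ 2) • a H y₀ y₁ z

end EnergyTwoStep

end

/-! Energy: integrating `H` along `curve` gives `H z - H y₀ = ⟨z - y₀, a⟩ - r` (`energy_increment`).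
Since `⟨x, J x⟩ = 0`, the term `2hJa` does no work, and the correction along `a` is scaled to
contribute exactly `r`; hence every solution conserves `H`.

Existence and uniqueness: on a ball of radius `ρ` about `y₀`, `a` stays close to `∇H(y₀) ≠ 0`. The
weight `2τ - 1` has mean zero, so `r` has size `ρ²` and Lipschitz constant of order `ρ`. For small
`ρ`, then small `h`, `stepMap` is a `1/2`-contraction of the ball into the ball of radius `ρ/2`.

Order: by the contraction, the error is at most twice the defect of `y(t₀ + 2h)` under `stepMap`.
The flow satisfies `y(t₀ + 2h) - y₀ = 2hJb`, with `b` the mean of `∇H` along it. Exact energy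
conservation bounds the correction term by `b - a` as well, so the defect is `O(h ‖b - a‖)`
(`norm_sub_stepMap_le`). Finally `b - a = O(h⁴)`: the interpolation error is `h³ q(τ) c₃ + O(h⁴)`
with a cubic `q` of mean zero, so its leading part vanishes after linearising `∇H` at `y₀`
(`norm_integral_gradient_sub_a_le`). -/

namespace EnergyTwoStep

variable {m : ℕ}

/-! ### The structure matrix and the interpolating curve -/

lemma J_apply_inl (x : Phase m) (i : Fin m) : J m x (Sum.inl i) = x (Sum.inr i) := by
  simp [J, Matrix.ofLp_toEuclideanCLM, Matrix.mulVec, dotProduct, Matrix.one_apply]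

lemma J_apply_inr (x : Phase m) (i : Fin m) : J m x (Sum.inr i) = -x (Sum.inl i) := by
  simp [J, Matrix.ofLp_toEuclideanCLM, Matrix.mulVec, dotProduct, Matrix.one_apply]

lemma inner_J_self (x : Phase m) : inner ℝ x (J m x) = 0 := by
  simp only [PiLp.inner_apply, Fintype.sum_sum_type, J_apply_inl, J_apply_inr,
    ← Finset.sum_add_distrib]
  refine Finset.sum_eq_zero fun i _ => ?_
  simp [mul_comm]

/-- Lagrange form relative to `y₀`. Both coefficients are bounded by 1 on `[0, 1]`, which confines
the curve near `y₀` and makes it 1-Lipschitz in `z`. -/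
lemma curve_eq (y₀ y₁ z : Phase m) (τ : ℝ) :
    curve y₀ y₁ z τ =
      y₀ + (2 * τ ^ 2 - τ) • (z - y₀) + (4 * (τ * (1 - τ))) • (y₁ - y₀) := by
  unfold curve; module

lemma curve_zero (y₀ y₁ z : Phase m) : curve y₀ y₁ z 0 = y₀ := by simp [curve]

lemma curve_one (y₀ y₁ z : Phase m) : curve y₀ y₁ z 1 = z := by simp [curve]

lemma abs_end_coeff_le {τ : ℝ} (hτ : τ ∈ Set.Icc (0 : ℝ) 1) : |2 * τ ^ 2 - τ| ≤ 1 := by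
  obtain ⟨h0, h1⟩ := hτ
  rw [abs_le]; constructor <;> nlinarith

lemma abs_mid_coeff_le {τ : ℝ} (hτ : τ ∈ Set.Icc (0 : ℝ) 1) : |4 * (τ * (1 - τ))| ≤ 1 := by
  obtain ⟨h0, h1⟩ := hτ
  rw [abs_le]; constructor <;> nlinarith [sq_nonneg (2 * τ - 1)]

lemma norm_curve_sub_le (y₀ y₁ z : Phase m) {τ : ℝ} (hτ : τ ∈ Set.Icc (0 : ℝ) 1) :
    ‖curve y₀ y₁ z τ - y₀‖ ≤ ‖z - y₀‖ + ‖y₁ - y₀‖ := by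
  rw [curve_eq, show y₀ + (2 * τ ^ 2 - τ) • (z - y₀) + (4 * (τ * (1 - τ))) • (y₁ - y₀) - y₀ =
    (2 * τ ^ 2 - τ) • (z - y₀) + (4 * (τ * (1 - τ))) • (y₁ - y₀) by module]
  refine (norm_add_le _ _).trans (add_le_add ?_ ?_) <;> rw [norm_smul, Real.norm_eq_abs]
  · exact mul_le_of_le_one_left (norm_nonneg _) (abs_end_coeff_le hτ)
  · exact mul_le_of_le_one_left (norm_nonneg _) (abs_mid_coeff_le hτ)

lemma norm_curve_sub_curve_le (y₀ y₁ z w : Phase m) {τ : ℝ} (hτ : τ ∈ Set.Icc (0 : ℝ) 1) :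
    ‖curve y₀ y₁ z τ - curve y₀ y₁ w τ‖ ≤ ‖z - w‖ := by
  rw [curve_eq, curve_eq, show y₀ + (2 * τ ^ 2 - τ) • (z - y₀) + (4 * (τ * (1 - τ))) • (y₁ - y₀) -
      (y₀ + (2 * τ ^ 2 - τ) • (w - y₀) + (4 * (τ * (1 - τ))) • (y₁ - y₀)) =
      (2 * τ ^ 2 - τ) • (z - w) by module, norm_smul, Real.norm_eq_abs]
  exact mul_le_of_le_one_left (norm_nonneg _) (abs_end_coeff_le hτ)

lemma hasDerivAt_curve (y₀ y₁ z : Phase m) (τ : ℝ) :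
    HasDerivAt (curve y₀ y₁ z)
      ((z - y₀) + (2 * (2 * τ - 1)) • (z - (2 : ℝ) • y₁ + y₀)) τ := by
  have h1 : HasDerivAt (fun τ : ℝ => τ • (z - y₀)) ((1 : ℝ) • (z - y₀)) τ :=
    (hasDerivAt_id τ).smul_const _
  have h2 : HasDerivAt (fun τ : ℝ => (2 * (τ * (τ - 1)))) (2 * (2 * τ - 1)) τ := by
    exact (((hasDerivAt_id' τ).fun_mul ((hasDerivAt_id' τ).sub_const 1)).const_mul 2).congr_deriv
      (by ring)
  have h3 := (h1.const_add y₀).add (h2.smul_const (z - (2 : ℝ) • y₁ + y₀))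
  rw [one_smul] at h3
  exact h3

lemma continuous_curve (y₀ y₁ z : Phase m) : Continuous (curve y₀ y₁ z) := by
  unfold curve; fun_prop

/-! ### Energy along the curve and along the flow -/

lemma contDiffOn_gradient {U : Set (Phase m)} (hU : IsOpen U) {H : Phase m → ℝ}
    (hH : ContDiffOn ℝ ∞ H U) : ContDiffOn ℝ ∞ (gradient H) U := by
  have h1 : ContDiffOn ℝ ∞ (fderiv ℝ H) U := hH.fderiv_of_isOpen hU (by simp)
  exact (InnerProductSpace.toDual ℝ (Phase m)).symm.contDiff.comp_contDiffOn h1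

lemma hasGradientAt_of_contDiffOn {U : Set (Phase m)} (hU : IsOpen U) {H : Phase m → ℝ}
    (hH : ContDiffOn ℝ ∞ H U) {x : Phase m} (hx : x ∈ U) :
    HasFDerivAt H (InnerProductSpace.toDual ℝ (Phase m) (gradient H x)) x :=
  (((hH.contDiffAt (hU.mem_nhds hx)).differentiableAt (by simp)).hasGradientAt).hasFDerivAt

/-- The gradient along a curve staying in the domain is continuous. -/
lemma continuousOn_gradient_curve {U : Set (Phase m)} (hU : IsOpen U) {H : Phase m → ℝ}
    (hH : ContDiffOn ℝ ∞ H U) {y₀ y₁ z : Phase m}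
    (hc : ∀ τ ∈ Set.Icc (0 : ℝ) 1, curve y₀ y₁ z τ ∈ U) :
    ContinuousOn (fun τ => gradient H (curve y₀ y₁ z τ)) (Set.Icc 0 1) :=
  (contDiffOn_gradient hU hH).continuousOn.comp (continuous_curve y₀ y₁ z).continuousOn hc

/-- The discrete line integral: the energy increment along the curve. -/
lemma energy_increment {U : Set (Phase m)} (hU : IsOpen U) {H : Phase m → ℝ}
    (hH : ContDiffOn ℝ ∞ H U) {y₀ y₁ z : Phase m}
    (hc : ∀ τ ∈ Set.Icc (0 : ℝ) 1, curve y₀ y₁ z τ ∈ U) :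
    H z - H y₀ = inner ℝ (z - y₀) (a H y₀ y₁ z) - r H y₀ y₁ z := by
  have hcont := continuousOn_gradient_curve hU hH hc
  have hcont' : ContinuousOn (fun τ => gradient H (curve y₀ y₁ z τ)) (Set.uIcc 0 1) := by
    rwa [Set.uIcc_of_le zero_le_one]
  have hcont2 : ContinuousOn (fun τ : ℝ => (2 * τ - 1) • gradient H (curve y₀ y₁ z τ))
      (Set.uIcc 0 1) := ContinuousOn.smul (f := fun τ : ℝ => 2 * τ - 1) (by fun_prop) hcont'
  set c := z - (2 : ℝ) • y₁ + y₀ with hcdef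
  have hder : ∀ τ ∈ Set.uIcc (0 : ℝ) 1, HasDerivAt (fun τ => H (curve y₀ y₁ z τ))
      (inner ℝ (z - y₀) (gradient H (curve y₀ y₁ z τ)) +
        2 * inner ℝ c ((2 * τ - 1) • gradient H (curve y₀ y₁ z τ))) τ := by
    intro τ hτ
    rw [Set.uIcc_of_le zero_le_one] at hτ
    have h := (hasGradientAt_of_contDiffOn hU hH (hc τ hτ)).comp_hasDerivAt τ
      (hasDerivAt_curve y₀ y₁ z τ)
    refine h.congr_deriv ?_
    simp only [InnerProductSpace.toDual_apply_apply, inner_add_right, inner_smul_right, ← hcdef]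
    rw [real_inner_comm, real_inner_comm c]
    ring
  have hi1 : ContinuousOn (fun τ : ℝ => inner ℝ (z - y₀) (gradient H (curve y₀ y₁ z τ)))
      (Set.uIcc 0 1) := continuousOn_const.inner hcont'
  have hi2 : ContinuousOn
      (fun τ : ℝ => 2 * inner ℝ c ((2 * τ - 1) • gradient H (curve y₀ y₁ z τ)))
      (Set.uIcc 0 1) := continuousOn_const.mul (continuousOn_const.inner hcont2)
  have hint := intervalIntegral.integral_eq_sub_of_hasDerivAt hder
    (hi1.add hi2).intervalIntegrable
  rw [curve_zero, curve_one, intervalIntegral.integral_add hi1.intervalIntegrable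
    hi2.intervalIntegrable, intervalIntegral.integral_const_mul] at hint
  have e1 : ∫ τ in (0 : ℝ)..1, inner ℝ (z - y₀) (gradient H (curve y₀ y₁ z τ)) =
      inner ℝ (z - y₀) (a H y₀ y₁ z) :=
    (innerSL ℝ (z - y₀)).intervalIntegral_comp_comm hcont'.intervalIntegrable
  have e2 : ∫ τ in (0 : ℝ)..1, inner ℝ c ((2 * τ - 1) • gradient H (curve y₀ y₁ z τ)) =
      inner ℝ c (∫ τ in (0 : ℝ)..1, (2 * τ - 1) • gradient H (curve y₀ y₁ z τ)) :=
    (innerSL ℝ c).intervalIntegral_comp_comm hcont2.intervalIntegrable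
  rw [← hint, e1, e2, r]
  ring

/-- Every solution of the method preserves the energy. -/
lemma energy_eq_of_methodEq {U : Set (Phase m)} (hU : IsOpen U) {H : Phase m → ℝ}
    (hH : ContDiffOn ℝ ∞ H U) {y₀ y₁ z : Phase m} {h : ℝ}
    (hw : WellDefinedAt U H y₀ y₁ z) (he : MethodEq H y₀ y₁ h z) : H z = H y₀ := by
  have h1 := energy_increment hU hH hw.1
  have h2 : z - y₀ = (2 * h) • J m (a H y₀ y₁ z)
    + (r H y₀ y₁ z / ‖a H y₀ y₁ z‖ ^ 2) • a H y₀ y₁ z := by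
    rw [sub_eq_iff_eq_add']
    exact he.trans (add_assoc _ _ _)
  have hn : ‖a H y₀ y₁ z‖ ^ 2 ≠ 0 := pow_ne_zero 2 (norm_ne_zero_iff.2 hw.2)
  have h3 : inner ℝ (z - y₀) (a H y₀ y₁ z) = r H y₀ y₁ z := by
    rw [h2, real_inner_comm, inner_add_right, inner_smul_right, inner_smul_right, inner_J_self,
      real_inner_self_eq_norm_sq, div_mul_cancel₀ _ hn]
    simp
  linarith

/-- The flow preserves the energy. -/
lemma IsHamiltonianSolution.energy_eq {U : Set (Phase m)} (hU : IsOpen U) {H : Phase m → ℝ}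
    (hH : ContDiffOn ℝ ∞ H U) {y₀ : Phase m} {t₀ T : ℝ} {y : ℝ → Phase m}
    (hy : IsHamiltonianSolution U H y₀ t₀ T y) {t : ℝ} (ht : t ∈ Set.Icc t₀ T) :
    H (y t) = H y₀ := by
  have hd : ∀ s ∈ Set.Icc t₀ T, HasDerivWithinAt (fun s => H (y s)) 0 (Set.Icc t₀ T) s := by
    intro s hs
    have h := (hasGradientAt_of_contDiffOn hU hH (hy.mem s hs)).comp_hasDerivWithinAt s
      (hy.deriv s hs)
    rwa [InnerProductSpace.toDual_apply_apply, inner_J_self] at h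
  have h := constant_of_has_deriv_right_zero (f := fun s => H (y s)) (a := t₀) (b := T)
    (fun s hs => (hd s hs).continuousWithinAt)
    (fun s hs => (hd s ⟨hs.1, hs.2.le⟩).mono_of_mem_nhdsWithin
      (Icc_mem_nhdsGE_of_mem hs)) t ht
  rw [h, hy.init]

/-! ### Regularity and Taylor expansion of the flow -/

/-- The flow is smooth. -/
lemma IsHamiltonianSolution.contDiffOn {U : Set (Phase m)} (hU : IsOpen U) {H : Phase m → ℝ}
    (hH : ContDiffOn ℝ ∞ H U) {y₀ : Phase m} {t₀ T : ℝ} (hT : t₀ < T) {y : ℝ → Phase m}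
    (hy : IsHamiltonianSolution U H y₀ t₀ T y) (n : ℕ) :
    ContDiffOn ℝ n y (Set.Icc t₀ T) := by
  induction n with
  | zero =>
    exact contDiffOn_zero.2 fun t ht => (hy.deriv t ht).continuousWithinAt
  | succ n ih =>
    have hu : UniqueDiffOn ℝ (Set.Icc t₀ T) := uniqueDiffOn_Icc hT
    push_cast
    rw [contDiffOn_succ_iff_derivWithin hu]
    refine ⟨fun t ht => (hy.deriv t ht).differentiableWithinAt, by simp, ?_⟩
    -- Bootstrap: if `y` is `C^n`, so is the right-hand side of the equation, hence `y` is
    -- `C^(n+1)`.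
    have hg : ContDiffOn ℝ n (fun x => J m (gradient H x)) U :=
      (J m).contDiff.comp_contDiffOn
        ((contDiffOn_gradient hU hH).of_le (by exact_mod_cast le_top))
    exact (hg.comp ih hy.mem).congr fun t ht => (hy.deriv t ht).derivWithin (hu t ht)

/-- Third order Taylor expansion of the flow at the initial time. -/
lemma IsHamiltonianSolution.exists_taylor {U : Set (Phase m)} (hU : IsOpen U) {H : Phase m → ℝ}
    (hH : ContDiffOn ℝ ∞ H U) {y₀ : Phase m} {t₀ T : ℝ} (hT : t₀ < T) {y : ℝ → Phase m}
    (hy : IsHamiltonianSolution U H y₀ t₀ T y) :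
    ∃ (c₁ c₂ c₃ : Phase m) (C : ℝ), ∀ s : ℝ, 0 ≤ s → t₀ + s ≤ T →
      ‖y (t₀ + s) - (y₀ + s • c₁ + s ^ 2 • c₂ + s ^ 3 • c₃)‖ ≤ C * s ^ 4 := by
  obtain ⟨C, hC⟩ := exists_taylor_mean_remainder_bound (n := 3) hT.le
    (by exact_mod_cast hy.contDiffOn hU hH hT 4)
  refine ⟨derivWithin y (Set.Icc t₀ T) t₀,
    (1 / 2 : ℝ) • iteratedDerivWithin 2 y (Set.Icc t₀ T) t₀,
    (1 / 6 : ℝ) • iteratedDerivWithin 3 y (Set.Icc t₀ T) t₀, C, fun s hs hsT => ?_⟩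
  have h := hC (t₀ + s) ⟨by linarith, hsT⟩
  simp only [taylorWithinEval_succ, taylor_within_zero_eval, add_sub_cancel_left, hy.init] at h
  norm_num [Nat.factorial] at h
  refine le_of_eq_of_le (congrArg norm ?_) h
  module

/-! ### Local estimates for the gradient -/

/-- First and second order Lipschitz bounds for a smooth vector field near a point. -/
lemma exists_local_bounds {E : Type*} [NormedAddCommGroup E] [NormedSpace ℝ E]
    {U : Set E} (hU : IsOpen U) {g : E → E} (hg : ContDiffOn ℝ ∞ g U) {x₀ : E} (hx₀ : x₀ ∈ U) :
    ∃ R > 0, ∃ K > 0, Metric.ball x₀ R ⊆ U ∧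
      (∀ u ∈ Metric.ball x₀ R, ∀ v ∈ Metric.ball x₀ R, ‖g u - g v‖ ≤ K * ‖u - v‖) ∧
      (∀ σ ≤ R, ∀ u ∈ Metric.ball x₀ σ, ∀ v ∈ Metric.ball x₀ σ,
        ‖g u - g v - fderiv ℝ g x₀ (u - v)‖ ≤ K * σ * ‖u - v‖) := by
  have hg1 : ContDiffAt ℝ 1 g x₀ := (hg.contDiffAt (hU.mem_nhds hx₀)).of_le (by simp)
  have hg2 : ContDiffAt ℝ 1 (fderiv ℝ g) x₀ :=
    ((hg.fderiv_of_isOpen (m := ∞) hU (by simp)).contDiffAt (hU.mem_nhds hx₀)).of_le (by simp)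
  obtain ⟨K₁, t₁, ht₁, hK₁⟩ := (hg1.hasStrictFDerivAt one_ne_zero).exists_lipschitzOnWith
  obtain ⟨K₂, t₂, ht₂, hK₂⟩ := (hg2.hasStrictFDerivAt one_ne_zero).exists_lipschitzOnWith
  obtain ⟨R, hR, hsub⟩ := Metric.mem_nhds_iff.1
    (inter_mem (inter_mem ht₁ ht₂) (hU.mem_nhds hx₀))
  refine ⟨R, hR, K₁ + K₂ + 1, by positivity, fun x hx => (hsub hx).2, fun u hu v hv => ?_,
    fun σ hσ u hu v hv => ?_⟩
  · refine (hK₁.norm_sub_le (hsub hu).1.1 (hsub hv).1.1).trans ?_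
    gcongr
    linarith [show (0 : ℝ) ≤ K₂ from K₂.2]
  · have hσR : Metric.ball x₀ σ ⊆ Metric.ball x₀ R := Metric.ball_subset_ball hσ
    have hσ0 : 0 < σ := Metric.pos_of_mem_ball hu
    have hd : ∀ x ∈ Metric.ball x₀ σ, HasFDerivWithinAt g (fderiv ℝ g x) (Metric.ball x₀ σ) x :=
      fun x hx => ((hg.contDiffAt (hU.mem_nhds (hsub (hσR hx)).2)).differentiableAt
        (by simp)).hasFDerivAt.hasFDerivWithinAt
    -- Mean value inequality for `g` minus its linearisation at `x₀`, whose derivative is `O(σ)` on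
    -- the ball because `fderiv ℝ g` is Lipschitz.
    refine (convex_ball x₀ σ).norm_image_sub_le_of_norm_hasFDerivWithin_le' hd (fun x hx => ?_) hv hu
    refine (hK₂.norm_sub_le (hsub (hσR hx)).1.2 (hsub (Metric.mem_ball_self hR)).1.2).trans ?_
    have hx' : ‖x - x₀‖ ≤ σ := (mem_ball_iff_norm.1 hx).le
    have h1 : (0 : ℝ) ≤ K₁ := K₁.2
    gcongr
    linarith

lemma norm_integral_sub_integral_le {E : Type*} [NormedAddCommGroup E] [NormedSpace ℝ E]
    {f g : ℝ → E} {C : ℝ} (hf : ContinuousOn f (Set.Icc 0 1)) (hg : ContinuousOn g (Set.Icc 0 1))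
    (h : ∀ τ ∈ Set.Icc (0 : ℝ) 1, ‖f τ - g τ‖ ≤ C) :
    ‖(∫ τ in (0 : ℝ)..1, f τ) - ∫ τ in (0 : ℝ)..1, g τ‖ ≤ C := by
  have hu : Set.uIcc (0 : ℝ) 1 = Set.Icc 0 1 := Set.uIcc_of_le zero_le_one
  rw [← intervalIntegral.integral_sub (hu ▸ hf).intervalIntegrable (hu ▸ hg).intervalIntegrable]
  refine (intervalIntegral.norm_integral_le_of_norm_le_const (C := C) fun τ hτ => ?_).trans
    (by simp)
  rw [Set.uIoc_of_le zero_le_one] at hτ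
  exact h τ ⟨hτ.1.le, hτ.2⟩

/-! ### The step map as a contraction -/

/-- The map whose fixed points are the solutions of the method. -/
noncomputable def stepMap (H : Phase m → ℝ) (y₀ y₁ : Phase m) (h : ℝ) (z : Phase m) : Phase m :=
  y₀ + (2 * h) • J m (a H y₀ y₁ z) + (r H y₀ y₁ z / ‖a H y₀ y₁ z‖ ^ 2) • a H y₀ y₁ z

/-- The first moment of the gradient along the curve. -/
noncomputable def gradientMoment (H : Phase m → ℝ) (y₀ y₁ z : Phase m) : Phase m :=
  ∫ τ in (0 : ℝ)..1, (2 * τ - 1) • gradient H (curve y₀ y₁ z τ)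

lemma r_eq (H : Phase m → ℝ) (y₀ y₁ z : Phase m) :
    r H y₀ y₁ z = -2 * inner ℝ (z - (2 : ℝ) • y₁ + y₀) (gradientMoment H y₀ y₁ z) := rfl

/-- Hypotheses on the data near the initial value, on a ball of radius `2 * ρ`. -/
structure LocalBounds (U : Set (Phase m)) (H : Phase m → ℝ) (y₀ : Phase m) (ρ K : ℝ) : Prop where
  isOpen : IsOpen U
  contDiffOn : ContDiffOn ℝ ∞ H U
  radius_pos : 0 < ρ
  lipschitz_pos : 0 < K
  ball_subset : Metric.ball y₀ (2 * ρ) ⊆ U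
  lipschitz : ∀ u ∈ Metric.ball y₀ (2 * ρ), ∀ v ∈ Metric.ball y₀ (2 * ρ),
    ‖gradient H u - gradient H v‖ ≤ K * ‖u - v‖

namespace LocalBounds

variable {U : Set (Phase m)} {H : Phase m → ℝ} {y₀ y₁ z w : Phase m} {ρ K : ℝ}

lemma curve_mem (hy₁ : y₁ ∈ Metric.ball y₀ ρ) (hz : z ∈ Metric.ball y₀ ρ)
    {τ : ℝ} (hτ : τ ∈ Set.Icc (0 : ℝ) 1) : curve y₀ y₁ z τ ∈ Metric.ball y₀ (2 * ρ) := by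
  rw [mem_ball_iff_norm] at *
  linarith [norm_curve_sub_le y₀ y₁ z hτ]

lemma continuousOn (hb : LocalBounds U H y₀ ρ K) (hy₁ : y₁ ∈ Metric.ball y₀ ρ)
    (hz : z ∈ Metric.ball y₀ ρ) :
    ContinuousOn (fun τ => gradient H (curve y₀ y₁ z τ)) (Set.Icc 0 1) :=
  continuousOn_gradient_curve hb.isOpen hb.contDiffOn
    fun _ hτ => hb.ball_subset (curve_mem hy₁ hz hτ)

lemma norm_gradient_sub_le (hb : LocalBounds U H y₀ ρ K) (hy₁ : y₁ ∈ Metric.ball y₀ ρ)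
    (hz : z ∈ Metric.ball y₀ ρ) (hw : w ∈ Metric.ball y₀ ρ) {τ : ℝ}
    (hτ : τ ∈ Set.Icc (0 : ℝ) 1) :
    ‖gradient H (curve y₀ y₁ z τ) - gradient H (curve y₀ y₁ w τ)‖ ≤ K * ‖z - w‖ :=
  (hb.lipschitz _ (curve_mem hy₁ hz hτ) _ (curve_mem hy₁ hw hτ)).trans
    (mul_le_mul_of_nonneg_left (norm_curve_sub_curve_le _ _ _ _ hτ) hb.lipschitz_pos.le)

lemma norm_gradient_sub_init_le (hb : LocalBounds U H y₀ ρ K) (hy₁ : y₁ ∈ Metric.ball y₀ ρ)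
    (hz : z ∈ Metric.ball y₀ ρ) {τ : ℝ} (hτ : τ ∈ Set.Icc (0 : ℝ) 1) :
    ‖gradient H (curve y₀ y₁ z τ) - gradient H y₀‖ ≤ K * (2 * ρ) := by
  have hρ := hb.radius_pos
  refine (hb.lipschitz _ (curve_mem hy₁ hz hτ) _ (Metric.mem_ball_self (by linarith))).trans
    (mul_le_mul_of_nonneg_left ?_ hb.lipschitz_pos.le)
  exact (mem_ball_iff_norm.1 (curve_mem hy₁ hz hτ)).le

lemma norm_a_sub_le (hb : LocalBounds U H y₀ ρ K) (hy₁ : y₁ ∈ Metric.ball y₀ ρ)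
    (hz : z ∈ Metric.ball y₀ ρ) (hw : w ∈ Metric.ball y₀ ρ) :
    ‖a H y₀ y₁ z - a H y₀ y₁ w‖ ≤ K * ‖z - w‖ :=
  norm_integral_sub_integral_le (hb.continuousOn hy₁ hz) (hb.continuousOn hy₁ hw)
    fun _ hτ => hb.norm_gradient_sub_le hy₁ hz hw hτ

lemma norm_a_sub_gradient_le (hb : LocalBounds U H y₀ ρ K) (hy₁ : y₁ ∈ Metric.ball y₀ ρ)
    (hz : z ∈ Metric.ball y₀ ρ) : ‖a H y₀ y₁ z - gradient H y₀‖ ≤ K * (2 * ρ) := by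
  have h := norm_integral_sub_integral_le (hb.continuousOn hy₁ hz)
    (continuousOn_const (c := gradient H y₀)) fun _ hτ => hb.norm_gradient_sub_init_le hy₁ hz hτ
  simpa [a] using h

lemma abs_weight_le {τ : ℝ} (hτ : τ ∈ Set.Icc (0 : ℝ) 1) : |2 * τ - 1| ≤ 1 := by
  rw [abs_le]; constructor <;> linarith [hτ.1, hτ.2]

lemma continuousOn_weight {f : ℝ → Phase m} {s : Set ℝ} (hf : ContinuousOn f s) :
    ContinuousOn (fun τ => (2 * τ - 1) • f τ) s :=
  ContinuousOn.smul (f := fun τ : ℝ => 2 * τ - 1) (by fun_prop) hf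

lemma norm_gradientMoment_sub_le (hb : LocalBounds U H y₀ ρ K) (hy₁ : y₁ ∈ Metric.ball y₀ ρ)
    (hz : z ∈ Metric.ball y₀ ρ) (hw : w ∈ Metric.ball y₀ ρ) :
    ‖gradientMoment H y₀ y₁ z - gradientMoment H y₀ y₁ w‖ ≤ K * ‖z - w‖ := by
  refine norm_integral_sub_integral_le (continuousOn_weight (hb.continuousOn hy₁ hz))
    (continuousOn_weight (hb.continuousOn hy₁ hw)) fun τ hτ => ?_
  rw [← smul_sub, norm_smul, Real.norm_eq_abs]
  exact (mul_le_of_le_one_left (norm_nonneg _) (abs_weight_le hτ)).trans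
    (hb.norm_gradient_sub_le hy₁ hz hw hτ)

/-- The weight `2τ - 1` has mean zero, so the constant `∇H(y₀)` can be subtracted under the
integral. This gains the factor `ρ` that makes `r` quadratically small. -/
lemma norm_gradientMoment_le (hb : LocalBounds U H y₀ ρ K) (hy₁ : y₁ ∈ Metric.ball y₀ ρ)
    (hz : z ∈ Metric.ball y₀ ρ) : ‖gradientMoment H y₀ y₁ z‖ ≤ K * (2 * ρ) := by
  have h0 : ∫ τ in (0 : ℝ)..1, (2 * τ - 1) • gradient H y₀ = 0 := by
    rw [intervalIntegral.integral_smul_const, intervalIntegral.integral_sub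
      (Continuous.intervalIntegrable (by fun_prop) _ _) (by simp),
      intervalIntegral.integral_const_mul, integral_id]
    norm_num
  rw [← sub_zero (gradientMoment H y₀ y₁ z), ← h0]
  refine norm_integral_sub_integral_le (continuousOn_weight (hb.continuousOn hy₁ hz))
    (continuousOn_weight continuousOn_const) fun τ hτ => ?_
  rw [← smul_sub, norm_smul, Real.norm_eq_abs]
  exact (mul_le_of_le_one_left (norm_nonneg _) (abs_weight_le hτ)).trans
    (hb.norm_gradient_sub_init_le hy₁ hz hτ)

lemma norm_second_difference_le (hy₁ : y₁ ∈ Metric.ball y₀ ρ) (hz : z ∈ Metric.ball y₀ ρ) :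
    ‖z - (2 : ℝ) • y₁ + y₀‖ ≤ 3 * ρ := by
  rw [mem_ball_iff_norm] at *
  calc ‖z - (2 : ℝ) • y₁ + y₀‖ = ‖(z - y₀) - (2 : ℝ) • (y₁ - y₀)‖ := by congr 1; module
    _ ≤ ‖z - y₀‖ + ‖(2 : ℝ) • (y₁ - y₀)‖ := norm_sub_le _ _
    _ = ‖z - y₀‖ + 2 * ‖y₁ - y₀‖ := by rw [norm_smul]; norm_num
    _ ≤ 3 * ρ := by linarith

lemma abs_r_le (hb : LocalBounds U H y₀ ρ K) (hy₁ : y₁ ∈ Metric.ball y₀ ρ)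
    (hz : z ∈ Metric.ball y₀ ρ) : |r H y₀ y₁ z| ≤ 12 * K * ρ ^ 2 := by
  have hρ := hb.radius_pos
  have hK := hb.lipschitz_pos
  rw [r_eq, abs_mul]
  have h := (abs_real_inner_le_norm (z - (2 : ℝ) • y₁ + y₀) (gradientMoment H y₀ y₁ z)).trans
    (mul_le_mul (norm_second_difference_le hy₁ hz) (hb.norm_gradientMoment_le hy₁ hz)
      (norm_nonneg _) (by positivity))
  norm_num
  linarith

lemma abs_r_sub_le (hb : LocalBounds U H y₀ ρ K) (hy₁ : y₁ ∈ Metric.ball y₀ ρ)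
    (hz : z ∈ Metric.ball y₀ ρ) (hw : w ∈ Metric.ball y₀ ρ) :
    |r H y₀ y₁ z - r H y₀ y₁ w| ≤ 10 * K * ρ * ‖z - w‖ := by
  have hρ := hb.radius_pos
  have hK := hb.lipschitz_pos
  have e : r H y₀ y₁ z - r H y₀ y₁ w = -2 * (inner ℝ (z - w) (gradientMoment H y₀ y₁ z) +
      inner ℝ (w - (2 : ℝ) • y₁ + y₀) (gradientMoment H y₀ y₁ z - gradientMoment H y₀ y₁ w)) := by
    rw [r_eq, r_eq, show z - (2 : ℝ) • y₁ + y₀ = (z - w) + (w - (2 : ℝ) • y₁ + y₀) by abel,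
      inner_add_left, inner_sub_right]
    ring
  have h1 := (abs_real_inner_le_norm (z - w) (gradientMoment H y₀ y₁ z)).trans
    (mul_le_mul_of_nonneg_left (hb.norm_gradientMoment_le hy₁ hz) (norm_nonneg _))
  have h2 := (abs_real_inner_le_norm (w - (2 : ℝ) • y₁ + y₀)
      (gradientMoment H y₀ y₁ z - gradientMoment H y₀ y₁ w)).trans
    (mul_le_mul (norm_second_difference_le hy₁ hw) (hb.norm_gradientMoment_sub_le hy₁ hz hw)
      (norm_nonneg _) (by positivity))
  rw [e, abs_mul]
  have h3 := abs_add_le (inner ℝ (z - w) (gradientMoment H y₀ y₁ z))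
    (inner ℝ (w - (2 : ℝ) • y₁ + y₀) (gradientMoment H y₀ y₁ z - gradientMoment H y₀ y₁ w))
  norm_num
  linarith

lemma norm_inv_sq_smul {E : Type*} [NormedAddCommGroup E] [NormedSpace ℝ E] (x : E) (s : ℝ) :
    ‖(s / ‖x‖ ^ 2) • x‖ = |s| / ‖x‖ := by
  rcases eq_or_ne x 0 with rfl | hx
  · simp
  have : ‖x‖ ≠ 0 := norm_ne_zero_iff.2 hx
  rw [norm_smul, Real.norm_eq_abs, abs_div, abs_of_nonneg (sq_nonneg ‖x‖)]
  field_simp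

/-- `a` deviates from `∇H(y₀)`, of norm at least `2δ`, by at most `2Kρ ≤ δ/50`. -/
lemma norm_le_norm_a (hb : LocalBounds U H y₀ ρ K) (hy₁ : y₁ ∈ Metric.ball y₀ ρ)
    (hz : z ∈ Metric.ball y₀ ρ) {δ : ℝ} (hδ : 2 * δ ≤ ‖gradient H y₀‖) (hρδ : 100 * (K * ρ) ≤ δ) :
    δ ≤ ‖a H y₀ y₁ z‖ := by
  have h1 := hb.norm_a_sub_gradient_le hy₁ hz
  have h2 := norm_sub_norm_le (gradient H y₀) (a H y₀ y₁ z)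
  rw [norm_sub_rev] at h2
  have : 0 < K * ρ := mul_pos hb.lipschitz_pos hb.radius_pos
  linarith

lemma norm_a_le (hb : LocalBounds U H y₀ ρ K) (hy₁ : y₁ ∈ Metric.ball y₀ ρ)
    (hz : z ∈ Metric.ball y₀ ρ) : ‖a H y₀ y₁ z‖ ≤ ‖gradient H y₀‖ + 2 * (K * ρ) := by
  have h1 := hb.norm_a_sub_gradient_le hy₁ hz
  have h2 := norm_sub_norm_le (a H y₀ y₁ z) (gradient H y₀)
  linarith

/-- The step map sends the ball of radius `ρ` into the closed ball of radius `ρ / 2`. -/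
lemma norm_stepMap_sub_init_le (hb : LocalBounds U H y₀ ρ K) (hy₁ : y₁ ∈ Metric.ball y₀ ρ)
    {δ h : ℝ} (hδ0 : 0 < δ) (hδ : 2 * δ ≤ ‖gradient H y₀‖) (hρδ : 100 * (K * ρ) ≤ δ)
    (hh : 0 < h) (hhρ : 2 * h * ‖J m‖ * (‖gradient H y₀‖ + 2 * (K * ρ)) ≤ ρ / 10)
    (hz : z ∈ Metric.ball y₀ ρ) : ‖stepMap H y₀ y₁ h z - y₀‖ ≤ ρ / 2 := by
  have hρ := hb.radius_pos
  have hK := hb.lipschitz_pos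
  have hδa := hb.norm_le_norm_a hy₁ hz hδ hρδ
  have h1 : ‖(2 * h) • J m (a H y₀ y₁ z)‖ ≤ ρ / 10 := by
    refine le_trans ?_ hhρ
    rw [norm_smul, Real.norm_eq_abs, abs_of_pos (by positivity), mul_assoc (2 * h)]
    gcongr
    exact ((J m).le_opNorm _).trans
      (mul_le_mul_of_nonneg_left (hb.norm_a_le hy₁ hz) (norm_nonneg _))
  -- Uses `|r| ≤ 12Kρ²` against `‖a‖ ≥ 100Kρ`.
  have h2 : ‖(r H y₀ y₁ z / ‖a H y₀ y₁ z‖ ^ 2) • a H y₀ y₁ z‖ ≤ ρ / 5 := by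
    rw [norm_inv_sq_smul, div_le_iff₀ (by linarith)]
    have h3 := hb.abs_r_le hy₁ hz
    nlinarith
  calc ‖stepMap H y₀ y₁ h z - y₀‖ = ‖(2 * h) • J m (a H y₀ y₁ z) +
        (r H y₀ y₁ z / ‖a H y₀ y₁ z‖ ^ 2) • a H y₀ y₁ z‖ := by
        rw [stepMap]; congr 1; abel
    _ ≤ _ := norm_add_le _ _
    _ ≤ ρ / 2 := by linarith

/-- The step map is a contraction on the ball of radius `ρ`. -/
lemma norm_stepMap_sub_le (hb : LocalBounds U H y₀ ρ K) (hy₁ : y₁ ∈ Metric.ball y₀ ρ)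
    {δ h : ℝ} (hδ0 : 0 < δ) (hδ : 2 * δ ≤ ‖gradient H y₀‖) (hρδ : 100 * (K * ρ) ≤ δ)
    (hh : 0 < h) (hhK : 2 * h * ‖J m‖ * K ≤ 1 / 10)
    (hz : z ∈ Metric.ball y₀ ρ) (hw : w ∈ Metric.ball y₀ ρ) :
    ‖stepMap H y₀ y₁ h z - stepMap H y₀ y₁ h w‖ ≤ 1 / 2 * ‖z - w‖ := by
  have hρ := hb.radius_pos
  have hK := hb.lipschitz_pos
  have hKρ : 0 < K * ρ := mul_pos hK hρ
  have hδz := hb.norm_le_norm_a hy₁ hz hδ hρδ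
  have hδw := hb.norm_le_norm_a hy₁ hw hδ hρδ
  have haK := hb.norm_a_sub_le hy₁ hz hw
  have hr := hb.abs_r_sub_le hy₁ hz hw
  have hrw := hb.abs_r_le hy₁ hw
  set az := a H y₀ y₁ z with haz
  set aw := a H y₀ y₁ w with haw
  set rz := r H y₀ y₁ z with hrz
  set rw' := r H y₀ y₁ w with hrw'
  set d := ‖z - w‖ with hd
  have hd0 : 0 ≤ d := norm_nonneg _
  have haz0 : az ≠ 0 := norm_pos_iff.1 (hδ0.trans_le hδz)
  have haw0 : aw ≠ 0 := norm_pos_iff.1 (hδ0.trans_le hδw)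
  have h1 : ‖(2 * h) • J m (az - aw)‖ ≤ 1 / 10 * d := by
    calc ‖(2 * h) • J m (az - aw)‖ = 2 * h * ‖J m (az - aw)‖ := by
          rw [norm_smul, Real.norm_eq_abs, abs_of_pos (by positivity)]
      _ ≤ 2 * h * (‖J m‖ * (K * d)) := by
          gcongr
          exact ((J m).le_opNorm _).trans (mul_le_mul_of_nonneg_left haK (norm_nonneg _))
      _ = 2 * h * ‖J m‖ * K * d := by ring
      _ ≤ 1 / 10 * d := by gcongr
  -- Here `10Kρ` is divided by `‖az‖ ≥ 100Kρ`: the factor 100 is exactly what yields `1/10`.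
  have h2 : ‖((rz - rw') / ‖az‖ ^ 2) • az‖ ≤ 1 / 10 * d := by
    rw [norm_inv_sq_smul, div_le_iff₀ (by linarith)]
    nlinarith [mul_nonneg hd0 (sub_nonneg.2 (hρδ.trans hδz))]
  -- The inversion `x ↦ x/‖x‖²` satisfies `dist = ‖x - y‖ / (‖x‖ ‖y‖)`; the form `(1 / ‖az‖) ^ 2`
  -- matches `dist_div_norm_sq_smul`.
  have h3 : ‖rw' • ((1 / ‖az‖) ^ 2 • az - (1 / ‖aw‖) ^ 2 • aw)‖ ≤ 1 / 10 * d := by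
    rw [norm_smul, ← dist_eq_norm, dist_div_norm_sq_smul haz0 haw0, dist_eq_norm,
      Real.norm_eq_abs, one_pow, one_div_mul_eq_div, ← mul_div_assoc, div_le_iff₀ (by positivity)]
    have h5 : |rw'| * ‖az - aw‖ ≤ 12 * K * ρ ^ 2 * (K * d) := by gcongr
    have h6 : (100 * (K * ρ)) * (100 * (K * ρ)) ≤ ‖az‖ * ‖aw‖ :=
      mul_le_mul (hρδ.trans hδz) (hρδ.trans hδw) (by positivity) (norm_nonneg _)
    nlinarith [mul_le_mul_of_nonneg_left h6 hd0, mul_nonneg hd0 (mul_pos hKρ hKρ).le]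
  have e : stepMap H y₀ y₁ h z - stepMap H y₀ y₁ h w = (2 * h) • J m (az - aw) +
      ((rz - rw') / ‖az‖ ^ 2) • az + rw' • ((1 / ‖az‖) ^ 2 • az - (1 / ‖aw‖) ^ 2 • aw) := by
    simp only [stepMap, ← haz, ← haw, ← hrz, ← hrw', map_sub, div_eq_mul_inv, one_mul, inv_pow]
    module
  rw [e]
  have h7 := norm_add₃_le (a := (2 * h) • J m (az - aw)) (b := ((rz - rw') / ‖az‖ ^ 2) • az)
    (c := rw' • ((1 / ‖az‖) ^ 2 • az - (1 / ‖aw‖) ^ 2 • aw))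
  linarith

end LocalBounds

/-- A `1/2`-contraction of an open ball into the concentric closed ball of half the radius has
a fixed point. -/
lemma exists_fixedPoint_of_contraction {E : Type*} [NormedAddCommGroup E] [CompleteSpace E]
    {x₀ : E} {ρ : ℝ} (hρ : 0 < ρ) {F : E → E}
    (hmap : ∀ z ∈ Metric.ball x₀ ρ, ‖F z - x₀‖ ≤ ρ / 2)
    (hlip : ∀ z ∈ Metric.ball x₀ ρ, ∀ w ∈ Metric.ball x₀ ρ, ‖F z - F w‖ ≤ 1 / 2 * ‖z - w‖) :
    ∃ z ∈ Metric.ball x₀ ρ, F z = z := by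
  -- The open ball is not complete in general, so Banach's theorem is applied on the closed
  -- half-radius ball.
  have hsub : Metric.closedBall x₀ (ρ / 2) ⊆ Metric.ball x₀ ρ :=
    Metric.closedBall_subset_ball (by linarith)
  have hmaps : Set.MapsTo F (Metric.closedBall x₀ (ρ / 2)) (Metric.closedBall x₀ (ρ / 2)) :=
    fun z hz => mem_closedBall_iff_norm.2 (hmap z (hsub hz))
  have hc : ContractingWith (1 / 2) (hmaps.restrict F _ _) := by
    refine ⟨by rw [← NNReal.coe_lt_coe]; norm_num, LipschitzWith.of_dist_le_mul fun z w => ?_⟩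
    rw [Subtype.dist_eq, Subtype.dist_eq, dist_eq_norm, dist_eq_norm]
    simpa using hlip z (hsub z.2) w (hsub w.2)
  obtain ⟨z, hz, hfix, -⟩ := hc.exists_fixedPoint' Metric.isClosed_closedBall.isComplete hmaps
    (Metric.mem_closedBall_self (by linarith)) (edist_ne_top _ _)
  exact ⟨z, hsub hz, hfix⟩

/-! ### Consistency: the defect of the exact flow -/

/-- The error of quadratic interpolation at `0`, `h`, `2h` is, up to fourth order, a multiple of
the cubic vanishing at the nodes. -/
lemma norm_sub_curve_sub_le {Y : ℝ → Phase m} {y₀ y₁ c₁ c₂ c₃ : Phase m} {C C₁ h : ℝ}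
    (hC : 0 ≤ C) (hh : 0 < h)
    (hY : ∀ s ∈ Set.Icc 0 (2 * h), ‖Y s - (y₀ + s • c₁ + s ^ 2 • c₂ + s ^ 3 • c₃)‖ ≤ C * s ^ 4)
    (hy₁ : ‖Y h - y₁‖ ≤ C₁ * h ^ 4) {τ : ℝ} (hτ : τ ∈ Set.Icc (0 : ℝ) 1) :
    ‖Y (2 * h * τ) - curve y₀ y₁ (Y (2 * h)) τ
      - (h ^ 3 * (8 * τ ^ 3 - 12 * τ ^ 2 + 4 * τ)) • c₃‖ ≤ (33 * C + C₁) * h ^ 4 := by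
  set P : ℝ → Phase m := fun s => y₀ + s • c₁ + s ^ 2 • c₂ + s ^ 3 • c₃ with hP
  -- Interpolation is exact on quadratics. On `s³` at `s = 2hτ` it gives `h³(12τ² - 4τ)`, leaving
  -- the displayed cubic. The constant below is `33 = 16 + 16 + 1`.
  have e : Y (2 * h * τ) - curve y₀ y₁ (Y (2 * h)) τ
      - (h ^ 3 * (8 * τ ^ 3 - 12 * τ ^ 2 + 4 * τ)) • c₃ =
      (Y (2 * h * τ) - P (2 * h * τ)) - (2 * τ ^ 2 - τ) • (Y (2 * h) - P (2 * h))
        - (4 * (τ * (1 - τ))) • (Y h - P h) + (4 * (τ * (1 - τ))) • (Y h - y₁) := by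
    rw [curve_eq, hP]; module
  have h1 : ‖Y (2 * h * τ) - P (2 * h * τ)‖ ≤ 16 * C * h ^ 4 := by
    refine (hY _ ⟨by have := hτ.1; positivity, mul_le_of_le_one_right (by positivity) hτ.2⟩).trans ?_
    have : τ ^ 4 ≤ 1 := pow_le_one₀ hτ.1 hτ.2
    have h4 : 0 ≤ 16 * C * h ^ 4 := by positivity
    nlinarith
  have h2 : ‖(2 * τ ^ 2 - τ) • (Y (2 * h) - P (2 * h))‖ ≤ 16 * C * h ^ 4 := by
    rw [norm_smul, Real.norm_eq_abs]
    refine (mul_le_of_le_one_left (norm_nonneg _) (abs_end_coeff_le hτ)).trans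
      ((hY _ ⟨by positivity, le_rfl⟩).trans (le_of_eq (by ring)))
  have h3 : ‖(4 * (τ * (1 - τ))) • (Y h - P h)‖ ≤ C * h ^ 4 := by
    rw [norm_smul, Real.norm_eq_abs]
    exact (mul_le_of_le_one_left (norm_nonneg _) (abs_mid_coeff_le hτ)).trans
      (hY _ ⟨hh.le, by linarith⟩)
  have h4 : ‖(4 * (τ * (1 - τ))) • (Y h - y₁)‖ ≤ C₁ * h ^ 4 := by
    rw [norm_smul, Real.norm_eq_abs]
    exact (mul_le_of_le_one_left (norm_nonneg _) (abs_mid_coeff_le hτ)).trans hy₁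
  rw [e]
  refine (norm_add_le _ _).trans ?_
  have h5 := norm_sub_le (Y (2 * h * τ) - P (2 * h * τ) -
    (2 * τ ^ 2 - τ) • (Y (2 * h) - P (2 * h))) ((4 * (τ * (1 - τ))) • (Y h - P h))
  have h6 := norm_sub_le (Y (2 * h * τ) - P (2 * h * τ))
    ((2 * τ ^ 2 - τ) • (Y (2 * h) - P (2 * h)))
  linarith

lemma abs_cubic_le {τ : ℝ} (hτ : τ ∈ Set.Icc (0 : ℝ) 1) :
    |8 * τ ^ 3 - 12 * τ ^ 2 + 4 * τ| ≤ 1 := by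
  rw [show 8 * τ ^ 3 - 12 * τ ^ 2 + 4 * τ = (4 * (τ * (1 - τ))) * (1 - 2 * τ) by ring, abs_mul]
  refine mul_le_one₀ (abs_mid_coeff_le hτ) (abs_nonneg _) ?_
  rw [abs_sub_comm]
  exact LocalBounds.abs_weight_le hτ

/-- The cubic `4τ(1 - τ)(1 - 2τ)` is odd about `τ = 1/2`. This symmetry supplies the extra power of
`h`. -/
lemma integral_cubic : ∫ τ in (0 : ℝ)..1, (8 * τ ^ 3 - 12 * τ ^ 2 + 4 * τ) = 0 := by
  rw [intervalIntegral.integral_add, intervalIntegral.integral_sub]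
  · rw [intervalIntegral.integral_const_mul, intervalIntegral.integral_const_mul,
      intervalIntegral.integral_const_mul, integral_pow, integral_pow, integral_id]
    norm_num
  all_goals exact Continuous.intervalIntegrable (by fun_prop) _ _

lemma norm_sub_init_le_of_taylor {x y₀ c₁ c₂ c₃ : Phase m} {C s : ℝ} (hC : 0 ≤ C)
    (hs : 0 ≤ s) (hs2 : s ≤ 2)
    (h : ‖x - (y₀ + s • c₁ + s ^ 2 • c₂ + s ^ 3 • c₃)‖ ≤ C * s ^ 4) :
    ‖x - y₀‖ ≤ (8 * C + ‖c₁‖ + 2 * ‖c₂‖ + 4 * ‖c₃‖) * s := by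
  have e : x - y₀ = (x - (y₀ + s • c₁ + s ^ 2 • c₂ + s ^ 3 • c₃)) + s • c₁ + s ^ 2 • c₂
      + s ^ 3 • c₃ := by module
  have h1 := norm_add_le ((x - (y₀ + s • c₁ + s ^ 2 • c₂ + s ^ 3 • c₃)) + s • c₁ + s ^ 2 • c₂)
    (s ^ 3 • c₃)
  have h2 := norm_add₃_le (a := x - (y₀ + s • c₁ + s ^ 2 • c₂ + s ^ 3 • c₃)) (b := s • c₁)
    (c := s ^ 2 • c₂)
  rw [← e] at h1
  simp only [norm_smul, norm_pow, Real.norm_eq_abs, abs_of_nonneg hs] at h1 h2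
  have p2 : s ^ 2 ≤ 2 * s := by nlinarith
  have p3 : s ^ 3 ≤ 4 * s := by nlinarith
  have p4 : s ^ 4 ≤ 8 * s := by nlinarith
  have q2 := mul_le_mul_of_nonneg_right p2 (norm_nonneg c₂)
  have q3 := mul_le_mul_of_nonneg_right p3 (norm_nonneg c₃)
  have q4 := mul_le_mul_of_nonneg_left p4 hC
  linarith

/-- The average of the gradient along the flow differs from the one along the interpolating
curve by a term of fourth order. -/
lemma norm_integral_gradient_sub_a_le {U : Set (Phase m)} (hU : IsOpen U) {H : Phase m → ℝ}
    (hH : ContDiffOn ℝ ∞ H U) {Y : ℝ → Phase m} {y₀ y₁ c₁ c₂ c₃ : Phase m}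
    {C C₁ B R K h : ℝ} (hC : 0 ≤ C) (hC₁ : 0 ≤ C₁) (hB : 0 ≤ B) (hK : 0 < K)
    (hRU : Metric.ball y₀ R ⊆ U)
    (hK2 : ∀ σ ≤ R, ∀ u ∈ Metric.ball y₀ σ, ∀ v ∈ Metric.ball y₀ σ,
      ‖gradient H u - gradient H v - fderiv ℝ (gradient H) y₀ (u - v)‖ ≤ K * σ * ‖u - v‖)
    (hh : 0 < h) (hh1 : h ≤ 1) (hhR : (2 * B + 1) * h ≤ R)
    (hYc : ContinuousOn Y (Set.Icc 0 (2 * h)))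
    (hYB : ∀ s ∈ Set.Icc 0 (2 * h), ‖Y s - y₀‖ ≤ B * h)
    (hyB : ‖y₁ - y₀‖ ≤ B * h)
    (hY : ∀ s ∈ Set.Icc 0 (2 * h), ‖Y s - (y₀ + s • c₁ + s ^ 2 • c₂ + s ^ 3 • c₃)‖ ≤ C * s ^ 4)
    (hy₁ : ‖Y h - y₁‖ ≤ C₁ * h ^ 4) :
    ‖(∫ τ in (0 : ℝ)..1, gradient H (Y (2 * h * τ))) - a H y₀ y₁ (Y (2 * h))‖ ≤
      (K * (2 * B + 1) * (‖c₃‖ + (33 * C + C₁)) +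
        ‖fderiv ℝ (gradient H) y₀‖ * (33 * C + C₁)) * h ^ 4 := by
  set A := fderiv ℝ (gradient H) y₀ with hA
  set q : ℝ → ℝ := fun τ => 8 * τ ^ 3 - 12 * τ ^ 2 + 4 * τ with hq
  have hs : ∀ τ ∈ Set.Icc (0 : ℝ) 1, 2 * h * τ ∈ Set.Icc 0 (2 * h) := fun τ hτ =>
    ⟨by have := hτ.1; positivity, mul_le_of_le_one_right (by positivity) hτ.2⟩
  have hBh : 0 ≤ B * h := by positivity
  have hYm : ∀ τ ∈ Set.Icc (0 : ℝ) 1, Y (2 * h * τ) ∈ Metric.ball y₀ ((2 * B + 1) * h) := by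
    intro τ hτ
    rw [mem_ball_iff_norm]
    linarith [hYB _ (hs τ hτ)]
  have hγm : ∀ τ ∈ Set.Icc (0 : ℝ) 1,
      curve y₀ y₁ (Y (2 * h)) τ ∈ Metric.ball y₀ ((2 * B + 1) * h) := by
    intro τ hτ
    rw [mem_ball_iff_norm]
    linarith [norm_curve_sub_le y₀ y₁ (Y (2 * h)) hτ, hYB (2 * h) ⟨by positivity, le_rfl⟩]
  have hsub : Metric.ball y₀ ((2 * B + 1) * h) ⊆ U :=
    (Metric.ball_subset_ball hhR).trans hRU
  have hc1 : ContinuousOn (fun τ => gradient H (Y (2 * h * τ))) (Set.Icc 0 1) :=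
    (contDiffOn_gradient hU hH).continuousOn.comp (hYc.comp (by fun_prop) hs)
      fun τ hτ => hsub (hYm τ hτ)
  have hc2 : ContinuousOn (fun τ => gradient H (curve y₀ y₁ (Y (2 * h)) τ)) (Set.Icc 0 1) :=
    continuousOn_gradient_curve hU hH fun τ hτ => hsub (hγm τ hτ)
  have hc3 : Continuous fun τ => (h ^ 3 * q τ) • A c₃ := by fun_prop
  have hu : Set.uIcc (0 : ℝ) 1 = Set.Icc 0 1 := Set.uIcc_of_le zero_le_one
  -- The mean-zero cubic term can be added for free, so a pointwise comparison of integrands to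
  -- order `h⁴` suffices.
  have hint : ∫ τ in (0 : ℝ)..1, (gradient H (curve y₀ y₁ (Y (2 * h)) τ) + (h ^ 3 * q τ) • A c₃) =
      a H y₀ y₁ (Y (2 * h)) := by
    rw [intervalIntegral.integral_add (hu ▸ hc2).intervalIntegrable (hc3.intervalIntegrable _ _),
      intervalIntegral.integral_smul_const, intervalIntegral.integral_const_mul, hq,
      integral_cubic]
    simp [a]
  rw [← hint]
  refine norm_integral_sub_integral_le hc1 (hc2.add hc3.continuousOn) fun τ hτ => ?_
  set u := Y (2 * h * τ) with hudef
  set v := curve y₀ y₁ (Y (2 * h)) τ with hvdef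
  have hε : ‖u - v - (h ^ 3 * q τ) • c₃‖ ≤ (33 * C + C₁) * h ^ 4 :=
    norm_sub_curve_sub_le hC hh hY hy₁ hτ
  have hp4 : h ^ 4 ≤ h ^ 3 := pow_le_pow_of_le_one hh.le hh1 (by norm_num)
  have huv : ‖u - v‖ ≤ (‖c₃‖ + (33 * C + C₁)) * h ^ 3 := by
    have h1 := norm_add_le (u - v - (h ^ 3 * q τ) • c₃) ((h ^ 3 * q τ) • c₃)
    rw [sub_add_cancel, norm_smul, Real.norm_eq_abs, abs_mul, abs_of_pos (pow_pos hh 3)] at h1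
    have h2 : h ^ 3 * |q τ| * ‖c₃‖ ≤ h ^ 3 * 1 * ‖c₃‖ := by
      gcongr
      exact abs_cubic_le hτ
    have h3 : (33 * C + C₁) * h ^ 4 ≤ (33 * C + C₁) * h ^ 3 := by gcongr
    linarith
  -- With the derivative frozen at `y₀`, the first bracket is `O(h) · O(h³)` and the second is `A`
  -- applied to the `O(h⁴)` interpolation remainder.
  have e : gradient H u - (gradient H v + (h ^ 3 * q τ) • A c₃) =
      (gradient H u - gradient H v - A (u - v)) + A (u - v - (h ^ 3 * q τ) • c₃) := by
    rw [map_sub A (u - v), map_smul]; abel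
  rw [e]
  calc _ ≤ ‖gradient H u - gradient H v - A (u - v)‖ + ‖A (u - v - (h ^ 3 * q τ) • c₃)‖ :=
        norm_add_le _ _
    _ ≤ K * ((2 * B + 1) * h) * ((‖c₃‖ + (33 * C + C₁)) * h ^ 3) +
        ‖A‖ * ((33 * C + C₁) * h ^ 4) := by
      gcongr
      · exact (hK2 _ hhR _ (hYm τ hτ) _ (hγm τ hτ)).trans
          (mul_le_mul_of_nonneg_left huv (by positivity))
      · exact (A.le_opNorm _).trans (mul_le_mul_of_nonneg_left hε (norm_nonneg _))
    _ = _ := by ring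

/-- The flow in integrated form. -/
lemma IsHamiltonianSolution.sub_eq_integral {U : Set (Phase m)} (hU : IsOpen U)
    {H : Phase m → ℝ} (hH : ContDiffOn ℝ ∞ H U) {y₀ : Phase m} {t₀ T : ℝ} {y : ℝ → Phase m}
    (hy : IsHamiltonianSolution U H y₀ t₀ T y) {h : ℝ} (hh : 0 < h) (hhT : t₀ + 2 * h ≤ T) :
    y (t₀ + 2 * h) - y₀ =
      (2 * h) • J m (∫ τ in (0 : ℝ)..1, gradient H (y (t₀ + 2 * h * τ))) := by
  have hs : ∀ τ ∈ Set.Icc (0 : ℝ) 1, t₀ + 2 * h * τ ∈ Set.Icc t₀ T := fun τ hτ =>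
    ⟨by have : 0 ≤ 2 * h * τ := mul_nonneg (by positivity) hτ.1
        linarith,
     by have : 2 * h * τ ≤ 2 * h := mul_le_of_le_one_right (by positivity) hτ.2
        linarith⟩
  have hyc : ContinuousOn (fun τ => y (t₀ + 2 * h * τ)) (Set.Icc 0 1) :=
    ContinuousOn.comp (g := y) (fun t ht => (hy.deriv t ht).continuousWithinAt)
      (by fun_prop : ContinuousOn (fun τ => t₀ + 2 * h * τ) (Set.Icc 0 1)) hs
  have hgc : ContinuousOn (fun τ => gradient H (y (t₀ + 2 * h * τ))) (Set.uIcc 0 1) := by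
    rw [Set.uIcc_of_le zero_le_one]
    exact (contDiffOn_gradient hU hH).continuousOn.comp hyc fun τ hτ => hy.mem _ (hs τ hτ)
  have hd : ∀ τ ∈ Set.Ioo (0 : ℝ) 1, HasDerivAt (fun τ => y (t₀ + 2 * h * τ))
      ((2 * h) • J m (gradient H (y (t₀ + 2 * h * τ)))) τ := by
    intro τ hτ
    have hmem : Set.Icc t₀ T ∈ 𝓝 (t₀ + 2 * h * τ) := Icc_mem_nhds
      (by have : 0 < 2 * h * τ := mul_pos (by positivity) hτ.1
          linarith)
      (by have : 2 * h * τ < 2 * h := mul_lt_of_lt_one_right (by positivity) hτ.2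
          linarith)
    have h1 := (hy.deriv _ (hs τ ⟨hτ.1.le, hτ.2.le⟩)).hasDerivAt hmem
    have h2 : HasDerivAt (fun τ : ℝ => t₀ + 2 * h * τ) (2 * h) τ := by
      simpa using ((hasDerivAt_id' τ).const_mul (2 * h)).const_add t₀
    exact h1.scomp τ h2
  have hJc : ContinuousOn (fun τ => J m (gradient H (y (t₀ + 2 * h * τ)))) (Set.uIcc 0 1) :=
    (J m).continuous.comp_continuousOn hgc
  have hint := intervalIntegral.integral_eq_sub_of_hasDerivAt_of_le zero_le_one hyc hd
    (hJc.const_smul (2 * h)).intervalIntegrable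
  rw [intervalIntegral.integral_smul,
    (J m).intervalIntegral_comp_comm hgc.intervalIntegrable] at hint
  rw [hint]
  simp [hy.init]

/-- A point with the right energy, reached by integrating an averaged gradient `b`, is almost
fixed by the step map if `b` is close to `a`. -/
lemma norm_sub_stepMap_le {U : Set (Phase m)} (hU : IsOpen U) {H : Phase m → ℝ}
    (hH : ContDiffOn ℝ ∞ H U) {y₀ y₁ z b : Phase m} {h : ℝ} (hh : 0 < h)
    (hw : WellDefinedAt U H y₀ y₁ z) (hHz : H z = H y₀) (hz : z - y₀ = (2 * h) • J m b) :
    ‖z - stepMap H y₀ y₁ h z‖ ≤ 4 * h * ‖J m‖ * ‖b - a H y₀ y₁ z‖ := by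
  have hE := energy_increment hU hH hw.1
  set α := a H y₀ y₁ z with hα
  have hα0 : 0 < ‖α‖ := norm_pos_iff.2 hw.2
  have hJ : ‖J m (b - α)‖ ≤ ‖J m‖ * ‖b - α‖ := (J m).le_opNorm _
  -- Equal energies force `r = ⟨z - y₀, α⟩`, and skewness of `J` removes the `α` part of `b`, so `r`
  -- is itself controlled by `b - α`.
  have hr : r H y₀ y₁ z = 2 * h * inner ℝ α (J m (b - α)) := by
    rw [map_sub, inner_sub_right, inner_J_self, sub_zero]
    rw [hHz, sub_self, hz, real_inner_comm, inner_smul_right] at hE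
    linarith
  have hr' : |r H y₀ y₁ z| ≤ 2 * h * ‖J m‖ * ‖b - α‖ * ‖α‖ := by
    rw [hr, abs_mul, abs_of_pos (by positivity : 0 < 2 * h)]
    calc 2 * h * |inner ℝ α (J m (b - α))| ≤ 2 * h * (‖α‖ * (‖J m‖ * ‖b - α‖)) := by
          gcongr
          exact (abs_real_inner_le_norm _ _).trans (mul_le_mul_of_nonneg_left hJ (norm_nonneg _))
      _ = _ := by ring
  have e : z - stepMap H y₀ y₁ h z =
      (2 * h) • J m (b - α) - (r H y₀ y₁ z / ‖α‖ ^ 2) • α := by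
    rw [stepMap, ← hα, map_sub, smul_sub, ← hz]; abel
  rw [e]
  refine (norm_sub_le _ _).trans ?_
  rw [LocalBounds.norm_inv_sq_smul, norm_smul, Real.norm_eq_abs,
    abs_of_pos (by positivity : 0 < 2 * h)]
  have h1 : |r H y₀ y₁ z| / ‖α‖ ≤ 2 * h * ‖J m‖ * ‖b - α‖ := (div_le_iff₀ hα0).2 hr'
  have h2 : 2 * h * ‖J m (b - α)‖ ≤ 2 * h * (‖J m‖ * ‖b - α‖) := by gcongr
  linarith

lemma eventually_mul_lt (c : ℝ) {ε : ℝ} (hε : 0 < ε) : ∀ᶠ h : ℝ in 𝓝[>] 0, c * h < ε := by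
  have : Tendsto (fun h : ℝ => c * h) (𝓝[>] 0) (𝓝 0) := by
    have h := (continuous_const_mul c).tendsto 0
    rw [mul_zero] at h
    exact h.mono_left nhdsWithin_le_nhds
  exact this.eventually (gt_mem_nhds hε)

end EnergyTwoStep

/-! ### Choice of constants and conclusion -/

theorem theorem1 (m : ℕ) (U : Set (EnergyTwoStep.Phase m)) (hU : IsOpen U)
    (H : EnergyTwoStep.Phase m → ℝ) (hH : ContDiffOn ℝ ∞ H U)
    (y₀ : EnergyTwoStep.Phase m) (hcrit : gradient H y₀ ≠ 0)
    (t₀ T : ℝ) (hT : t₀ < T) (y : ℝ → EnergyTwoStep.Phase m)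
    (hy : EnergyTwoStep.IsHamiltonianSolution U H y₀ t₀ T y)
    (y₁ : ℝ → EnergyTwoStep.Phase m)
    (hA1 : (fun h : ℝ => y (t₀ + h) - y₁ h) =O[𝓝[>] 0] (fun h : ℝ => h ^ 5)) :
    (∃ ρ > 0, ∃ h₀ > 0, ∃ zs : ℝ → EnergyTwoStep.Phase m,
      (∀ h : ℝ, 0 < h → h ≤ h₀ →
        (∀ z ∈ Metric.ball y₀ ρ, EnergyTwoStep.WellDefinedAt U H y₀ (y₁ h) z) ∧
        zs h ∈ Metric.ball y₀ ρ ∧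
        EnergyTwoStep.MethodEq H y₀ (y₁ h) h (zs h) ∧
        (∀ z ∈ Metric.ball y₀ ρ, EnergyTwoStep.MethodEq H y₀ (y₁ h) h z → z = zs h)) ∧
      (fun h : ℝ => y (t₀ + 2 * h) - zs h) =O[𝓝[>] 0] (fun h : ℝ => h ^ 5)) ∧
    (∀ h : ℝ, 0 < h → ∀ z : EnergyTwoStep.Phase m,
      EnergyTwoStep.WellDefinedAt U H y₀ (y₁ h) z →
      EnergyTwoStep.MethodEq H y₀ (y₁ h) h z → H z = H y₀) := by
  open EnergyTwoStep in
  refine ⟨?_, fun h _ z hw he => energy_eq_of_methodEq hU hH hw he⟩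
  have hy₀U : y₀ ∈ U := hy.init ▸ hy.mem t₀ ⟨le_rfl, hT.le⟩
  obtain ⟨R, hR, K, hK, hRU, hK1, hK2⟩ := exists_local_bounds hU (contDiffOn_gradient hU hH) hy₀U
  obtain ⟨c₁, c₂, c₃, C', hC'⟩ := hy.exists_taylor hU hH hT
  obtain ⟨C, hC, hTay⟩ : ∃ C : ℝ, 0 ≤ C ∧ ∀ s : ℝ, 0 ≤ s → t₀ + s ≤ T →
      ‖y (t₀ + s) - (y₀ + s • c₁ + s ^ 2 • c₂ + s ^ 3 • c₃)‖ ≤ C * s ^ 4 :=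
    ⟨|C'|, abs_nonneg _, fun s hs hsT => (hC' s hs hsT).trans
      (mul_le_mul_of_nonneg_right (le_abs_self _) (by positivity))⟩
  obtain ⟨C₁, hC₁, hy₁O⟩ := hA1.exists_pos
  have hy₁C := hy₁O.bound
  set D := 8 * C + ‖c₁‖ + 2 * ‖c₂‖ + 4 * ‖c₃‖ with hD
  have hD0 : 0 ≤ D := by positivity
  -- `2D` bounds the displacement of the flow for `s ≤ 2h`, per unit of `h`; `C₁` adds the error of
  -- `y₁`.
  set B := 2 * D + C₁ with hBdef
  have hB : 0 ≤ B := by positivity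
  set δ := ‖gradient H y₀‖ / 2 with hδdef
  have hδ0 : 0 < δ := half_pos (norm_pos_iff.2 hcrit)
  -- `R / 2` because the curve may reach distance `2ρ` from `y₀`; the other term gives `100Kρ ≤ δ`.
  set ρ := min (R / 2) (δ / (100 * K)) with hρdef
  have hρ : 0 < ρ := lt_min (by positivity) (by positivity)
  have hρR : 2 * ρ ≤ R := by linarith [min_le_left (R / 2) (δ / (100 * K))]
  have hρδ : 100 * (K * ρ) ≤ δ := by
    have := (le_div_iff₀ (by positivity)).1 (min_le_right (R / 2) (δ / (100 * K)))
    rw [← hρdef] at this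
    linarith
  have hδ2 : 2 * δ ≤ ‖gradient H y₀‖ := by rw [hδdef]; linarith
  have hb : LocalBounds U H y₀ ρ K := ⟨hU, hH, hρ, hK,
    (Metric.ball_subset_ball hρR).trans hRU, fun u hu v hv =>
      hK1 u (Metric.ball_subset_ball hρR hu) v (Metric.ball_subset_ball hρR hv)⟩
  have hev : ∀ᶠ h : ℝ in 𝓝[>] 0, 0 < h ∧ h ≤ 1 ∧ t₀ + 2 * h ≤ T ∧
      ‖y (t₀ + h) - y₁ h‖ ≤ C₁ * h ^ 5 ∧ B * h < ρ ∧ (2 * B + 1) * h ≤ R ∧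
      2 * h * ‖J m‖ * K ≤ 1 / 10 ∧
      2 * h * ‖J m‖ * (‖gradient H y₀‖ + 2 * (K * ρ)) ≤ ρ / 10 := by
    filter_upwards [self_mem_nhdsWithin, eventually_mul_lt 1 one_pos,
      eventually_mul_lt 2 (sub_pos.2 hT), hy₁C, eventually_mul_lt B hρ,
      eventually_mul_lt (2 * B + 1) hR,
      eventually_mul_lt (2 * ‖J m‖ * K) (by norm_num : (0 : ℝ) < 1 / 10),
      eventually_mul_lt (2 * ‖J m‖ * (‖gradient H y₀‖ + 2 * (K * ρ)))
        (by positivity : 0 < ρ / 10)] with h h1 h2 h3 h4 h5 h6 h7 h8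
    rw [Real.norm_eq_abs, abs_of_pos (pow_pos h1 5)] at h4
    exact ⟨h1, by linarith, by linarith, h4, h5, h6.le, by linarith, by linarith⟩
  obtain ⟨h₀, hh₀, hgood⟩ := mem_nhdsGT_iff_exists_Ioc_subset.1 hev
  have hYB : ∀ h ∈ Set.Ioc 0 h₀, ∀ s ∈ Set.Icc 0 (2 * h), ‖y (t₀ + s) - y₀‖ ≤ 2 * D * h := by
    intro h hh s hs
    obtain ⟨hpos, hle1, hhT, -⟩ := hgood hh
    have h1 := norm_sub_init_le_of_taylor hC hs.1 (by linarith [hs.2])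
      (hTay s hs.1 (by linarith [hs.2]))
    have h2 := mul_le_mul_of_nonneg_left hs.2 hD0
    linarith
  have hy₁B : ∀ h ∈ Set.Ioc 0 h₀, ‖y (t₀ + h) - y₁ h‖ ≤ C₁ * h ^ 4 ∧ ‖y₁ h - y₀‖ ≤ B * h := by
    intro h hh
    obtain ⟨hpos, hle1, hhT, hy5, -⟩ := hgood hh
    have h1 := hYB h hh h ⟨hpos.le, by linarith⟩
    have h2 : C₁ * h ^ 5 ≤ C₁ * h ^ 4 := by
      gcongr C₁ * ?_
      exact pow_le_pow_of_le_one hpos.le hle1 (by norm_num)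
    have h3 : C₁ * h ^ 5 ≤ C₁ * h := by
      gcongr C₁ * ?_
      exact pow_le_of_le_one hpos.le hle1 (by norm_num)
    refine ⟨hy5.trans h2, ?_⟩
    have h4 := norm_sub_le_norm_sub_add_norm_sub (y₁ h) (y (t₀ + h)) y₀
    rw [norm_sub_rev (y₁ h) (y (t₀ + h))] at h4
    rw [hBdef]
    linarith
  have hy₁ρ : ∀ h ∈ Set.Ioc 0 h₀, y₁ h ∈ Metric.ball y₀ ρ := fun h hh =>
    mem_ball_iff_norm.2 ((hy₁B h hh).2.trans_lt (hgood hh).2.2.2.2.1)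
  have hwd : ∀ h ∈ Set.Ioc 0 h₀, ∀ z ∈ Metric.ball y₀ ρ, WellDefinedAt U H y₀ (y₁ h) z :=
    fun h hh z hz => ⟨fun τ hτ => hb.ball_subset (LocalBounds.curve_mem (hy₁ρ h hh) hz hτ),
      norm_pos_iff.1 (hδ0.trans_le (hb.norm_le_norm_a (hy₁ρ h hh) hz hδ2 hρδ))⟩
  have hlip : ∀ h ∈ Set.Ioc 0 h₀, ∀ z ∈ Metric.ball y₀ ρ, ∀ w ∈ Metric.ball y₀ ρ,
      ‖stepMap H y₀ (y₁ h) h z - stepMap H y₀ (y₁ h) h w‖ ≤ 1 / 2 * ‖z - w‖ :=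
    fun h hh z hz w hw => hb.norm_stepMap_sub_le (hy₁ρ h hh) hδ0 hδ2 hρδ hh.1
      (hgood hh).2.2.2.2.2.2.1 hz hw
  have hfix : ∀ h : ℝ, ∃ z, h ∈ Set.Ioc 0 h₀ →
      z ∈ Metric.ball y₀ ρ ∧ stepMap H y₀ (y₁ h) h z = z := by
    intro h
    by_cases hh : h ∈ Set.Ioc 0 h₀
    · obtain ⟨z, hz, hz'⟩ := exists_fixedPoint_of_contraction hρ
        (fun z hz => hb.norm_stepMap_sub_init_le (hy₁ρ h hh) hδ0 hδ2 hρδ hh.1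
          (hgood hh).2.2.2.2.2.2.2 hz) (hlip h hh)
      exact ⟨z, fun _ => ⟨hz, hz'⟩⟩
    -- Outside `(0, h₀]` the value of `zs` is irrelevant.
    · exact ⟨0, fun hh' => absurd hh' hh⟩
  choose zs hzs using hfix
  refine ⟨ρ, hρ, h₀, hh₀, zs, fun h h1 h2 => ⟨hwd h ⟨h1, h2⟩, (hzs h ⟨h1, h2⟩).1,
    (hzs h ⟨h1, h2⟩).2.symm, fun z hz he => ?_⟩, ?_⟩
  · have h3 := hlip h ⟨h1, h2⟩ z hz (zs h) (hzs h ⟨h1, h2⟩).1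
    rw [(hzs h ⟨h1, h2⟩).2, show stepMap H y₀ (y₁ h) h z = z from he.symm] at h3
    exact sub_eq_zero.1 (norm_le_zero_iff.1 (by linarith [norm_nonneg (z - zs h)]))
  · set M := K * (2 * B + 1) * (‖c₃‖ + (33 * C + C₁)) +
        ‖fderiv ℝ (gradient H) y₀‖ * (33 * C + C₁) with hM
    -- The defect is at most `4h‖J‖ · Mh⁴`, and the contraction constant `1/2` doubles it.
    refine IsBigO.of_bound (8 * ‖J m‖ * M) ?_
    filter_upwards [Ioc_mem_nhdsGT hh₀] with h hh
    obtain ⟨hpos, hle1, hhT, -, hBρ, hBR, -⟩ := hgood hh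
    have hYB' : ∀ s ∈ Set.Icc 0 (2 * h), ‖y (t₀ + s) - y₀‖ ≤ B * h := fun s hs =>
      (hYB h hh s hs).trans (mul_le_mul_of_nonneg_right (by linarith) hpos.le)
    have hmem : ∀ s ∈ Set.Icc 0 (2 * h), t₀ + s ∈ Set.Icc t₀ T := fun s hs =>
      ⟨by linarith [hs.1], by linarith [hs.2]⟩
    have hYc : ContinuousOn (fun s => y (t₀ + s)) (Set.Icc 0 (2 * h)) :=
      ContinuousOn.comp (g := y) (fun t ht => (hy.deriv t ht).continuousWithinAt)
        (by fun_prop : ContinuousOn (fun s => t₀ + s) (Set.Icc 0 (2 * h))) hmem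
    have h2h : 2 * h ∈ Set.Icc 0 (2 * h) := ⟨by positivity, le_rfl⟩
    have hz : y (t₀ + 2 * h) ∈ Metric.ball y₀ ρ :=
      mem_ball_iff_norm.2 ((hYB' _ h2h).trans_lt hBρ)
    have hdefect := norm_integral_gradient_sub_a_le hU hH (Y := fun s => y (t₀ + s)) hC hC₁.le hB
      hK hRU hK2 hpos hle1 hBR hYc hYB' (hy₁B h hh).2
      (fun s hs => hTay s hs.1 (hmem s hs).2) (hy₁B h hh).1
    have hstep := norm_sub_stepMap_le hU hH hpos (hwd h hh _ hz)
      (hy.energy_eq hU hH (hmem _ h2h)) (hy.sub_eq_integral hU hH hpos hhT)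
    have hcontr := hlip h hh _ hz _ (hzs h hh).1
    rw [(hzs h hh).2] at hcontr
    have htri := norm_sub_le_norm_sub_add_norm_sub (y (t₀ + 2 * h))
      (stepMap H y₀ (y₁ h) h (y (t₀ + 2 * h))) (zs h)
    have hfin := mul_le_mul_of_nonneg_left hdefect (by positivity : 0 ≤ 4 * h * ‖J m‖)
    rw [Real.norm_eq_abs, abs_of_pos (pow_pos hpos 5)]
    have e : 8 * ‖J m‖ * M * h ^ 5 = 2 * (4 * h * ‖J m‖ * (M * h ^ 4)) := by ring
    rw [e]
    linarith
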